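/- **Model.** Consider a network with a source $s$, a sink $t$ and $c$ columns, column $j\in\{1,\dots,c\}$ consisting of nodes $(1,j),\dots,(r_j,j)$; it is a directed graph whose edges lead only from $s$ to column $1$, from column $j$ to column $j+1$ for $1\le j<c$, or from column $c$ to $t$ (hence it is acyclic), and are otherwise arbitrary. A path $\vec p=(s,p_1,\dots,p_c,t)$ from $s$ to $t$ visits exactly one node $(p_j,j)$ of each column; write $\vec p[j]=p_j$. Let $\vec{\mathcal P}$ be a uniformly distributed random path and let $S=(S(i,j))$ be a random real matrix indexed by the nodes, defined on the same probability space, whose entries are jointly independent and have finite second moments. The quality of $\vec{\mathcal P}$ is $b(\vec{\mathcal P})=\sum_{j=1}^c S(\vec{\mathcal P}[j],j)$. Let $(\vec{\mathcal P}_k,b(\vec{\mathcal P}_k))_{k\ge1}$ be a sequence of i.i.d. random variables distributed as $(\vec{\mathcal P},b(\vec{\mathcal P}))$. **Estimators.** For a node $(i,j)$ let $D^{(n)}_{(i,j)}$ be the multiset of those paths among $\vec{\mathcal P}_1,\dots,\vec{\mathcal P}_n$ that pass through $(i,j)$, i.e. $\vec{\mathcal P}_k[j]=i$, counted with multiplicity.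 Put $$T^{(n)}(i,j)=\frac1{|D^{(n)}_{(i,j)}|}\sum_{k\le n,\ \vec{\mathcal P}_k[j]=i} b(\vec{\mathcal P}_k),\qquad \Sigma^{(n)}(i,j)=\frac1{|D^{(n)}_{(i,j)}|}\sum_{k\le n,\ \vec{\mathcal P}_k[j]=i}\bigl(b(\vec{\mathcal P}_k)-T^{(n)}(i,j)\bigr)^2,$$ both being $0$ if $|D^{(n)}_{(i,j)}|=0$. **Claim.** Let $(i,j)$ be a node that lies on at least one path from $s$ to $t$, and put $$\mu_{i,j}=\mathbb E\bigl[b(\vec{\mathcal P})\mid\vec{\mathcal P}[j]=i\bigr],\qquad \sigma^2_{i,j}=\mathbb E\bigl[b(\vec{\mathcal P})^2\mid\vec{\mathcal P}[j]=i\bigr]-\mathbb E\bigl[b(\vec{\mathcal P})\mid\vec{\mathcal P}[j]=i\bigr]^2 .$$ Then $\sigma^2_{i,j}\ge0$ and, as $n\to\infty$, $$\sqrt{|D^{(n)}_{(i,j)}|}\,\bigl(T^{(n)}(i,j)-\mu_{i,j}\bigr)\xrightarrow{\ \mathcal D\ }\mathcal N(0,\sigma^2_{i,j}).$$ If moreover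 all entries of $S$ have finite fourth moments, then with $$\tau^2_{i,j}=\mathbb E\bigl[(b(\vec{\mathcal P})-\mu_{i,j})^4\mid\vec{\mathcal P}[j]=i\bigr]-\mathbb E\bigl[(b(\vec{\mathcal P})-\mu_{i,j})^2\mid\vec{\mathcal P}[j]=i\bigr]^2$$ one has $\tau^2_{i,j}\ge0$ and, as $n\to\infty$, $$\sqrt{|D^{(n)}_{(i,j)}|}\,\bigl(\Sigma^{(n)}(i,j)-\sigma^2_{i,j}\bigr)\xrightarrow{\ \mathcal D\ }\mathcal N(0,\tau^2_{i,j}).$$ Here $\mathcal N(0,0)$ denotes the unit point mass at $0$. -/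

import Mathlib

open MeasureTheory ProbabilityTheory Filter

noncomputable section

namespace PathNetwork

/-- The vertices of a network with `c` columns, column `j` having the `r j` nodes `(i, j)`,
together with a source `s` and a sink `t`. -/
inductive Vertex {c : ℕ} (r : Fin c → ℕ) : Type
  | source : Vertex r
  | node (j : Fin c) (i : Fin (r j)) : Vertex r
  | sink : Vertex r

/-- The column in which a vertex lies; the source is column `0`, the sink is column `c + 1`. -/
def Vertex.level {c : ℕ} {r : Fin c → ℕ} : Vertex r → ℕ
  | .source => 0
  | .node j _ => j + 1
  | .sink => c + 1

/-- A column network: a directed graph on the source, the nodes of the columns and the sink,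
whose edges lead from a column to the next one.  The edges are otherwise arbitrary. -/
structure Network {c : ℕ} (r : Fin c → ℕ) where
  graph : Digraph (Vertex r)
  layered : ∀ v w, graph.Adj v w → w.level = v.level + 1

/-- A network has no directed cycles. -/
theorem Network.acyclic {c : ℕ} {r : Fin c → ℕ} (N : Network r) (v : Vertex r) :
    ¬ Relation.TransGen N.graph.Adj v v := by
  have key : ∀ w, Relation.TransGen N.graph.Adj v w → v.level < w.level := by
    intro w h
    induction h with
    | single h => have := N.layered _ _ h; omega
    | tail _ h ih => have := N.layered _ _ h; omega
  intro h
  exact lt_irrefl _ (key v h)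

/-- The vertex sequence `(p₀, p₁, …, p_c, p_{c+1})` with `p₀ = s`, `p_{c+1} = t` that is given by
the choice `p j` of a node in each column. -/
def vertexSeq {c : ℕ} {r : Fin c → ℕ} (p : (j : Fin c) → Fin (r j)) : Fin (c + 2) → Vertex r :=
  Fin.cons Vertex.source (Fin.snoc (fun j => Vertex.node j (p j)) Vertex.sink)

/-- The paths from the source to the sink.  A path is recorded by the node `p.1 j` that it visits
in each column `j`, and consecutive vertices have to be joined by edges. -/
abbrev Network.Path {c : ℕ} {r : Fin c → ℕ} (N : Network r) : Type :=
  {p : (j : Fin c) → Fin (r j) //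
    ∀ k : Fin (c + 1), N.graph.Adj (vertexSeq p k.castSucc) (vertexSeq p k.succ)}

/-- Quality matrices; `S j i` is the entry of node `(i, j)` (row `i`, column `j`). -/
abbrev QualityMatrix {c : ℕ} (r : Fin c → ℕ) : Type := (j : Fin c) → Fin (r j) → ℝ

variable {c : ℕ} {r : Fin c → ℕ} {N : Network r}

/-- The quality `b(p) = ∑ⱼ S(pⱼ, j)` of the path `p`. -/
def quality (S : QualityMatrix r) (p : N.Path) : ℝ := ∑ j, S j (p.1 j)

/-- The indicator matrix `V_p` of the path `p`. -/
def indicatorMatrix (p : N.Path) (j : Fin c) (i : Fin (r j)) : ℝ := if p.1 j = i then 1 else 0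

/-! ### Estimators

The data are paths `p 0, p 1, …` with outputs `b 0, b 1, …`; the first `n` of them are used. -/

/-- The multiset of those among the first `n` paths that go through node `(i, j)`, each path
represented by its index, which keeps track of multiplicities. -/
def pathsThrough (p : ℕ → N.Path) (n : ℕ) (j : Fin c) (i : Fin (r j)) : Finset ℕ :=
  (Finset.range n).filter fun k => (p k).1 j = i

/-- `B⁽ⁿ⁾ = ∑ₖ b(pₖ) V_{pₖ}`. -/
def sumMatrix (p : ℕ → N.Path) (b : ℕ → ℝ) (n : ℕ) (j : Fin c) (i : Fin (r j)) : ℝ :=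
  ∑ k ∈ Finset.range n, b k * indicatorMatrix (p k) j i

/-- `V⁽ⁿ⁾ = ∑ₖ V_{pₖ}`. -/
def countMatrix (p : ℕ → N.Path) (n : ℕ) (j : Fin c) (i : Fin (r j)) : ℝ :=
  ∑ k ∈ Finset.range n, indicatorMatrix (p k) j i

theorem countMatrix_eq_card (p : ℕ → N.Path) (n : ℕ) (j : Fin c) (i : Fin (r j)) :
    countMatrix p n j i = ((pathsThrough p n j i).card : ℝ) := by
  simp [countMatrix, indicatorMatrix, pathsThrough]

/-- The sample mean matrix `T⁽ⁿ⁾`. -/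
def sampleMean (p : ℕ → N.Path) (b : ℕ → ℝ) (n : ℕ) (j : Fin c) (i : Fin (r j)) : ℝ :=
  open Classical in
  if countMatrix p n j i ≠ 0 then sumMatrix p b n j i / countMatrix p n j i else 0

/-- The sample variance matrix `Σ⁽ⁿ⁾`. -/
def sampleVariance (p : ℕ → N.Path) (b : ℕ → ℝ) (n : ℕ) (j : Fin c) (i : Fin (r j)) : ℝ :=
  open Classical in
  if countMatrix p n j i ≠ 0 then
    (∑ k ∈ pathsThrough p n j i, (b k - sampleMean p b n j i) ^ 2) / countMatrix p n j i
  else 0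

/-! ### Parameters of the model

`P` is the law under which the random path `X` and the random quality matrix `S` are chosen. -/

variable {Ω : Type*} [MeasurableSpace Ω]

/-- The conditional measure `P(· | X[j] = i)`. -/
def condThrough (P : Measure Ω) (X : Ω → N.Path) (j : Fin c) (i : Fin (r j)) : Measure Ω :=
  ProbabilityTheory.cond P {ω | (X ω).1 j = i}

/-- `μ_{i,j} = E[b(X) | X[j] = i]`. -/
def condMean (P : Measure Ω) (X : Ω → N.Path) (S : Ω → QualityMatrix r)
    (j : Fin c) (i : Fin (r j)) : ℝ :=
  ∫ ω, quality (S ω) (X ω) ∂(condThrough P X j i)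

/-- `σ²_{i,j} = E[b(X)² | X[j] = i] - E[b(X) | X[j] = i]²`. -/
def condVariance (P : Measure Ω) (X : Ω → N.Path) (S : Ω → QualityMatrix r)
    (j : Fin c) (i : Fin (r j)) : ℝ :=
  (∫ ω, quality (S ω) (X ω) ^ 2 ∂(condThrough P X j i)) - condMean P X S j i ^ 2

/-- `τ²_{i,j} = E[(b(X) - μ_{i,j})⁴ | X[j] = i] - E[(b(X) - μ_{i,j})² | X[j] = i]²`. -/
def condTauSq (P : Measure Ω) (X : Ω → N.Path) (S : Ω → QualityMatrix r)
    (j : Fin c) (i : Fin (r j)) : ℝ :=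
  (∫ ω, (quality (S ω) (X ω) - condMean P X S j i) ^ 4 ∂(condThrough P X j i)) -
    (∫ ω, (quality (S ω) (X ω) - condMean P X S j i) ^ 2 ∂(condThrough P X j i)) ^ 2

end PathNetwork

end

/-! The number of observed paths through the node is random, but no conditioning on it is needed.
Let `A` be the event of passing through the node and `q > 0` its probability. Both the sum of `f`
over the observations in `A` and their number are sums over all `n` i.i.d. observations, of `1_A f`
and of `1_A`. If `f` has conditional mean `0` and conditional variance `v`, then `1_A f` has mean
`0` and variance `q v`. The classical CLT gives the limit `N(0, q v)` after division by `√n`, the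
law of large numbers gives `count / n → q`, and Slutsky's theorem yields `N(0, v)` after division by
`√count`: this is `tendstoInDistribution_hitSum_div_sqrt_hitCount`.

For the sample mean, take `f = b - μ`. For the sample variance, take `f = (b - μ)² - σ²`; replacing
`μ` by the sample mean `T` costs `√count (T - μ) · (T - μ)` (`sqrt_card_mul_sampleVariance_sub`), a
factor converging in law times one tending to `0` in probability, so Slutsky's theorem removes it.
-/

open scoped Topology

namespace PathNetwork

/-! ### Integrals under conditioning on an event -/

section ConditionalIntegral

variable {Ω : Type*} [MeasurableSpace Ω] {P : Measure Ω}

/-- The integral over an event is the probability of the event times the conditional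
expectation. -/
theorem setIntegral_eq_measureReal_mul_integral_cond [IsProbabilityMeasure P] {s : Set Ω}
    (hs : P s ≠ 0) (f : Ω → ℝ) :
    ∫ ω in s, f ω ∂P = P.real s * ∫ ω, f ω ∂(cond P s) := by
  have h : P.real s ≠ 0 := by simpa [measureReal_eq_zero_iff] using hs
  rw [ProbabilityTheory.cond, integral_smul_measure, ENNReal.toReal_inv, smul_eq_mul, ← measureReal_def,
    mul_inv_cancel_left₀ h]

theorem memLp_cond {s : Set Ω} (hs : P s ≠ 0) {f : Ω → ℝ} {p : ENNReal} (hf : MemLp f p P) :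
    MemLp f p (cond P s) :=
  (hf.restrict s).smul_measure (ENNReal.inv_ne_top.2 hs)

end ConditionalIntegral

/-! ### Slutsky-type lemmas -/

section ConvergenceInDistribution

variable {Ω Ω' : Type*} [MeasurableSpace Ω] [MeasurableSpace Ω'] {P : Measure Ω} {Q : Measure Ω'}
  [IsProbabilityMeasure P] [IsProbabilityMeasure Q]

/-- Convergence in distribution to a constant implies convergence in probability. -/
theorem tendstoInMeasure_of_tendstoInDistribution_const {U : ℕ → Ω' → ℝ} {Z : Ω → ℝ} {a : ℝ}
    (hZ : ∀ ω, Z ω = a) (h : TendstoInDistribution U atTop Z (fun _ => Q) P) :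
    TendstoInMeasure Q U atTop fun _ => a := by
  obtain rfl : Z = fun _ => a := funext hZ
  rw [tendstoInMeasure_iff_norm]
  intro ε hε
  have hclosed : IsClosed {x : ℝ | ε ≤ ‖x - a‖} :=
    isClosed_le continuous_const (by fun_prop)
  -- Portmanteau applies because the frontier lies in the sphere of radius `ε > 0` about `a`, which
  -- the point mass at `a` does not charge.
  have hfront : (P.map fun _ => a) (frontier {x : ℝ | ε ≤ ‖x - a‖}) = 0 := by
    refine measure_mono_null
      (frontier_le_subset_eq continuous_const (by fun_prop : Continuous fun x : ℝ => ‖x - a‖)) ?_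
    rw [Measure.map_apply measurable_const
      (isClosed_eq continuous_const (by fun_prop)).measurableSet]
    simp [hε.ne']
  have := ProbabilityMeasure.tendsto_measure_of_null_frontier_of_tendsto' h.tendsto hfront
  convert this using 2 with n
  · exact (Measure.map_apply_of_aemeasurable (h.forall_aemeasurable n) hclosed.measurableSet).symm
  · change 0 = (P.map fun _ => a) _
    rw [Measure.map_apply measurable_const hclosed.measurableSet]
    simp [hε.not_ge]

/-- If `U n` converges in distribution and `R n` converges to `0` in probability, then `U n * R n`
converges to `0` in probability. -/
theorem tendstoInMeasure_mul_zero {U R : ℕ → Ω' → ℝ} {Z : Ω → ℝ}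
    (hU : TendstoInDistribution U atTop Z (fun _ => Q) P)
    (hR : TendstoInMeasure Q R atTop fun _ => 0) (hRm : ∀ n, AEMeasurable (R n) Q) :
    TendstoInMeasure Q (fun n ω => U n ω * R n ω) atTop fun _ => 0 :=
  tendstoInMeasure_of_tendstoInDistribution_const (fun ω => mul_zero (Z ω))
    (hU.continuous_comp_prodMk_of_tendstoInMeasure_const (g := fun x : ℝ × ℝ => x.1 * x.2)
      (by fun_prop) hR hRm)

end ConvergenceInDistribution

/-! ### Limit theorems for the observations falling in an event -/

section Subsample

variable {Ω Ω' β : Type*} [MeasurableSpace Ω] [MeasurableSpace Ω'] [MeasurableSpace β]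

/-- The sum of the values of `f` at those among the first `n` observations that lie in `A`. -/
noncomputable def hitSum (z : ℕ → Ω' → β) (A : Set β) (f : β → ℝ) (n : ℕ) (ω : Ω') : ℝ :=
  ∑ k ∈ Finset.range n, A.indicator f (z k ω)

variable {P : Measure Ω} [IsProbabilityMeasure P] {Q : Measure Ω'}
  {z : ℕ → Ω' → β} {W : Ω → β} {A : Set β} {f : β → ℝ}

theorem measurable_hitSum (hz : ∀ k, Measurable (z k)) (hA : MeasurableSet A)
    (hf : Measurable f) (n : ℕ) : Measurable (hitSum z A f n) :=
  Finset.measurable_fun_sum _ fun k _ => (hf.indicator hA).comp (hz k)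

theorem integral_indicator_comp (hW : Measurable W) (hA : MeasurableSet A)
    (hWA : P (W ⁻¹' A) ≠ 0) (f : β → ℝ) :
    ∫ ω, A.indicator f (W ω) ∂P =
      P.real (W ⁻¹' A) * ∫ ω, f (W ω) ∂(cond P (W ⁻¹' A)) := by
  rw [← setIntegral_eq_measureReal_mul_integral_cond hWA, ← integral_indicator (hW hA)]
  rfl

/-- The law of large numbers for the observations in `A`. -/
theorem tendsto_hitSum_div (hlaw : ∀ k, IdentDistrib (z k) W Q P) (hindep : iIndepFun z Q)
    (hW : Measurable W) (hA : MeasurableSet A) (hWA : P (W ⁻¹' A) ≠ 0) (hf : Measurable f)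
    (hint : Integrable (fun ω => f (W ω)) P) :
    ∀ᵐ ω ∂Q, Tendsto (fun n : ℕ => hitSum z A f n ω / n) atTop
      (𝓝 (P.real (W ⁻¹' A) * ∫ ω, f (W ω) ∂(cond P (W ⁻¹' A)))) := by
  have hm : Measurable (A.indicator f) := hf.indicator hA
  have hid (k : ℕ) : IdentDistrib (A.indicator f ∘ z k) (A.indicator f ∘ W) Q P :=
    (hlaw k).comp hm
  have hi : Integrable (A.indicator f ∘ W) P := hint.indicator (hW hA)
  have := strong_law_ae_real (fun k => A.indicator f ∘ z k) ((hid 0).integrable_iff.2 hi)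
    (fun k l hkl => (hindep.indepFun hkl).comp hm hm) fun k => (hid k).trans (hid 0).symm
  rw [(hid 0).integral_eq] at this
  simp only [Function.comp_def, integral_indicator_comp hW hA hWA] at this
  exact this

theorem tendsto_hitCount_div (hlaw : ∀ k, IdentDistrib (z k) W Q P) (hindep : iIndepFun z Q)
    (hW : Measurable W) (hA : MeasurableSet A) (hWA : P (W ⁻¹' A) ≠ 0) :
    ∀ᵐ ω ∂Q, Tendsto (fun n : ℕ => hitSum z A 1 n ω / n) atTop (𝓝 (P.real (W ⁻¹' A))) := by
  have := cond_isProbabilityMeasure hWA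
  simpa using tendsto_hitSum_div (f := 1) hlaw hindep hW hA hWA measurable_const (by simp)

variable [IsProbabilityMeasure Q]

/-- The central limit theorem for the observations in `A`, normalized by the sample size. -/
theorem tendstoInDistribution_inv_sqrt_mul_hitSum (hlaw : ∀ k, IdentDistrib (z k) W Q P)
    (hindep : iIndepFun z Q) (hW : Measurable W) (hA : MeasurableSet A) (hWA : P (W ⁻¹' A) ≠ 0)
    (hf : Measurable f) (hL2 : MemLp (fun ω => f (W ω)) 2 P)
    (hmean : ∫ ω, f (W ω) ∂(cond P (W ⁻¹' A)) = 0) {v : ℝ}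
    (hv : ∫ ω, f (W ω) ^ 2 ∂(cond P (W ⁻¹' A)) = v) :
    TendstoInDistribution (fun (n : ℕ) ω => (√n)⁻¹ * hitSum z A f n ω) atTop
      (fun x => √(P.real (W ⁻¹' A)) * x) (fun _ => Q) (gaussianReal 0 v.toNNReal) := by
  have hm : Measurable (A.indicator f) := hf.indicator hA
  have hid (k : ℕ) : IdentDistrib (A.indicator f ∘ z k) (A.indicator f ∘ W) Q P :=
    (hlaw k).comp hm
  have hL : MemLp (A.indicator f ∘ W) 2 P := hL2.indicator (hW hA)
  have hmean' : ∫ ω, (A.indicator f ∘ W) ω ∂P = 0 := by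
    simp only [Function.comp_def, integral_indicator_comp hW hA hWA, hmean, mul_zero]
  -- The mean is `0` and the square of `1_A f` is `1_A f²`, whose integral is `q v`.
  have hvar : Var[A.indicator f ∘ z 0; Q] = P.real (W ⁻¹' A) * v := by
    rw [(hid 0).variance_eq, variance_eq_sub hL, hmean', ← hv,
      ← integral_indicator_comp hW hA hWA (fun y => f y ^ 2)]
    have (ω : Ω) : A.indicator f (W ω) ^ 2 = A.indicator (fun y => f y ^ 2) (W ω) := by
      by_cases h : W ω ∈ A <;> simp [h]
    simp [this]
  -- `N(0, q v)` is realized as `√q x` under `N(0, v)`, so that the factor `√q` can later be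
  -- cancelled pointwise.
  have hY : HasLaw (fun x : ℝ => √(P.real (W ⁻¹' A)) * x)
      (gaussianReal 0 (Var[A.indicator f ∘ z 0; Q]).toNNReal) (gaussianReal 0 v.toNNReal) := by
    have := gaussianReal_const_mul (HasLaw.id (μ := gaussianReal 0 v.toNNReal))
      √(P.real (W ⁻¹' A))
    rw [mul_zero] at this
    have hcoe : (Var[A.indicator f ∘ z 0; Q]).toNNReal =
        NNReal.mk (√(P.real (W ⁻¹' A)) ^ 2) (sq_nonneg _) * v.toNNReal := by
      rw [hvar, Real.toNNReal_mul measureReal_nonneg]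
      congr 1
      ext
      simp [measureReal_nonneg]
    rw [hcoe]
    exact this
  have := tendstoInDistribution_inv_sqrt_mul_sum_sub (X := fun k => A.indicator f ∘ z k) hY
    ((hid 0).memLp_iff.2 hL) (hindep.comp (fun _ => A.indicator f) fun _ => hm)
    fun k => (hid k).trans (hid 0).symm
  refine this.congr (fun n => ae_of_all _ fun ω => ?_) (ae_of_all _ fun x => rfl)
  rw [(hid 0).integral_eq, hmean', mul_zero, sub_zero]
  rfl

/-- Averages over the observations in `A` converge to `0` in probability if the conditional mean
vanishes. -/
theorem tendstoInMeasure_hitSum_div_hitCount (hz : ∀ k, Measurable (z k))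
    (hlaw : ∀ k, IdentDistrib (z k) W Q P) (hindep : iIndepFun z Q)
    (hW : Measurable W) (hA : MeasurableSet A) (hWA : P (W ⁻¹' A) ≠ 0) (hf : Measurable f)
    (hint : Integrable (fun ω => f (W ω)) P)
    (hmean : ∫ ω, f (W ω) ∂(cond P (W ⁻¹' A)) = 0) :
    TendstoInMeasure Q (fun n ω => hitSum z A f n ω / hitSum z A 1 n ω) atTop fun _ => 0 := by
  have hq : P.real (W ⁻¹' A) ≠ 0 := by simpa [measureReal_eq_zero_iff] using hWA
  refine tendstoInMeasure_of_tendsto_ae (fun n => ((measurable_hitSum hz hA hf n).div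
    (measurable_hitSum hz hA measurable_one n)).aestronglyMeasurable) ?_
  filter_upwards [tendsto_hitSum_div hlaw hindep hW hA hWA hf hint,
    tendsto_hitCount_div hlaw hindep hW hA hWA] with ω h₁ h₂
  rw [hmean, mul_zero] at h₁
  have := h₁.div h₂ hq
  rw [zero_div] at this
  refine this.congr' ?_
  filter_upwards [eventually_ne_atTop 0] with n hn
  exact div_div_div_cancel_right₀ (Nat.cast_ne_zero.2 hn) _ _

/-- The central limit theorem for the observations in `A`, normalized by their number. -/
theorem tendstoInDistribution_hitSum_div_sqrt_hitCount (hz : ∀ k, Measurable (z k))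
    (hlaw : ∀ k, IdentDistrib (z k) W Q P)
    (hindep : iIndepFun z Q) (hW : Measurable W) (hA : MeasurableSet A) (hWA : P (W ⁻¹' A) ≠ 0)
    (hf : Measurable f) (hL2 : MemLp (fun ω => f (W ω)) 2 P)
    (hmean : ∫ ω, f (W ω) ∂(cond P (W ⁻¹' A)) = 0) {v : ℝ}
    (hv : ∫ ω, f (W ω) ^ 2 ∂(cond P (W ⁻¹' A)) = v) :
    TendstoInDistribution (fun (n : ℕ) ω => hitSum z A f n ω / √(hitSum z A 1 n ω)) atTop
      (id : ℝ → ℝ) (fun _ => Q) (gaussianReal 0 v.toNNReal) := by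
  have hq : √(P.real (W ⁻¹' A)) ≠ 0 := by
    rw [Real.sqrt_ne_zero measureReal_nonneg]
    simpa [measureReal_eq_zero_iff] using hWA
  have hmeas (n : ℕ) : Measurable fun ω => (√(hitSum z A 1 n ω / n))⁻¹ :=
    ((measurable_hitSum hz hA measurable_one n).div_const _).sqrt.inv
  -- Slutsky factor that changes the normalization from `√n` to `√count`.
  have hlim : TendstoInMeasure Q (fun (n : ℕ) ω => (√(hitSum z A 1 n ω / n))⁻¹) atTop
      fun _ => (√(P.real (W ⁻¹' A)))⁻¹ := by
    refine tendstoInMeasure_of_tendsto_ae (fun n => (hmeas n).aestronglyMeasurable) ?_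
    filter_upwards [tendsto_hitCount_div hlaw hindep hW hA hWA] with ω h
    exact h.sqrt.inv₀ hq
  have := (tendstoInDistribution_inv_sqrt_mul_hitSum hlaw hindep hW hA hWA hf hL2 hmean
    hv).continuous_comp_prodMk_of_tendstoInMeasure_const (g := fun x : ℝ × ℝ => x.1 * x.2)
      (by fun_prop) hlim fun n => (hmeas n).aemeasurable
  refine this.congr (fun n => ae_of_all _ fun ω => ?_) (ae_of_all _ fun x => ?_)
  -- For `n ≠ 0` only `√n` is cancelled; if the count vanishes, both sides are `0` by the convention
  -- for division by zero.
  · rcases eq_or_ne n 0 with rfl | hn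
    · simp [hitSum]
    · have : √(n : ℝ) ≠ 0 := by positivity
      simp only [Real.sqrt_div' _ (Nat.cast_nonneg n), inv_div]
      field_simp
  · simp only [id]
    field_simp

end Subsample

variable {c : ℕ} {r : Fin c → ℕ} {N : Network r}

/-! ### Measurability and moments of the path quality -/

section Moments

/-- Trades the random index `X[j]` for fixed indices and events, which reduces measurability and
integrability of the quality to those of single entries. -/
theorem quality_eq_sum_indicator {Ω : Type*} (S : Ω → QualityMatrix r)
    (X : Ω → N.Path) (ω : Ω) :
    quality (S ω) (X ω) =
      ∑ j, ∑ i, {ω | (X ω).1 j = i}.indicator (fun ω => S ω j i) ω := by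
  simp [quality, Set.indicator_apply]

variable {Ω : Type*} [MeasurableSpace Ω] {P : Measure Ω} {X : Ω → N.Path}
  {S : Ω → QualityMatrix r}

theorem measurableSet_preimage_node (hX : Measurable X) (j : Fin c) (i : Fin (r j)) :
    MeasurableSet {ω | (X ω).1 j = i} :=
  hX (Set.toFinite {q : N.Path | q.1 j = i}).measurableSet

/-- The uniform law on the finite set of paths charges every path, in particular one through the
node. -/
theorem measure_node_ne_zero (hX : Measurable X) (huniform : P.map X = uniformOn Set.univ)
    {j : Fin c} {i : Fin (r j)} (hij : ∃ q : N.Path, q.1 j = i) :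
    P {ω | (X ω).1 j = i} ≠ 0 := by
  classical
  obtain ⟨q, hq⟩ := hij
  have := Fintype.ofFinite N.Path
  have hmap := Measure.map_apply (μ := P) hX (Set.toFinite {q : N.Path | q.1 j = i}).measurableSet
  rw [huniform, uniformOn_univ] at hmap
  change P (X ⁻¹' {q : N.Path | q.1 j = i}) ≠ 0
  rw [← hmap]
  refine ENNReal.div_ne_zero.2 ⟨?_, ENNReal.natCast_ne_top _⟩
  exact Measure.count_ne_zero ⟨q, hq⟩

theorem measurable_quality (hX : Measurable X) (hS : Measurable S) :
    Measurable fun ω => quality (S ω) (X ω) := by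
  simp only [quality_eq_sum_indicator]
  refine Finset.measurable_fun_sum _ fun j _ => Finset.measurable_fun_sum _ fun i _ => ?_
  exact ((measurable_pi_apply i).comp ((measurable_pi_apply j).comp hS)).indicator
    (measurableSet_preimage_node hX j i)

theorem memLp_quality (hX : Measurable X) {p : ENNReal}
    (hS : ∀ (j : Fin c) (i : Fin (r j)), MemLp (fun ω => S ω j i) p P) :
    MemLp (fun ω => quality (S ω) (X ω)) p P := by
  simp only [quality_eq_sum_indicator]
  exact memLp_finsetSum _ fun j _ => memLp_finsetSum _ fun i _ =>
    (hS j i).indicator (measurableSet_preimage_node hX j i)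

theorem memLp_two_sq {f : Ω → ℝ} (hf : MemLp f 4 P) : MemLp (fun ω => f ω ^ 2) 2 P := by
  -- Hölder's inequality with `1/4 + 1/4 = 1/2`.
  have : ENNReal.HolderTriple 4 4 2 := ⟨by
    rw [← two_mul, show (4 : ENNReal) = 2 * 2 by norm_num,
      ENNReal.mul_inv (by simp) (by simp), ← mul_assoc,
      ENNReal.mul_inv_cancel (by simp) (by simp), one_mul]⟩
  have h : MemLp (f * f) 2 P := hf.mul hf
  simpa only [pow_two] using! h

/-- Both sides are the variance of the quality under the conditional law; the centred form shows the
sign and is what the CLT requires. -/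
theorem condVariance_eq_integral {j : Fin c} {i : Fin (r j)}
    [IsProbabilityMeasure (condThrough P X j i)]
    (h : MemLp (fun ω => quality (S ω) (X ω)) 2 (condThrough P X j i)) :
    condVariance P X S j i =
      ∫ ω, (quality (S ω) (X ω) - condMean P X S j i) ^ 2 ∂(condThrough P X j i) := by
  exact (variance_eq_sub h).symm.trans (variance_eq_integral h.aemeasurable)

/-- Both sides are the conditional variance of `(b - μ)²`, whose conditional mean is `σ²`. -/
theorem condTauSq_eq_integral {j : Fin c} {i : Fin (r j)}
    [IsProbabilityMeasure (condThrough P X j i)]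
    (h : MemLp (fun ω => quality (S ω) (X ω)) 2 (condThrough P X j i))
    (h' : MemLp (fun ω => (quality (S ω) (X ω) - condMean P X S j i) ^ 2) 2
      (condThrough P X j i)) :
    condTauSq P X S j i =
      ∫ ω, ((quality (S ω) (X ω) - condMean P X S j i) ^ 2 - condVariance P X S j i) ^ 2
        ∂(condThrough P X j i) := by
  have hv := variance_eq_integral h'.aemeasurable
  rw [← condVariance_eq_integral h] at hv
  rw [← hv, variance_eq_sub h', condTauSq]
  simp only [Pi.pow_apply, ← pow_mul]

end Moments

/-! ### Subsample sums as sums over the paths through a node -/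

section Estimators

variable {Ω' : Type*} (p : ℕ → Ω' → N.Path) (b : ℕ → Ω' → ℝ) (n : ℕ) (j : Fin c) (i : Fin (r j))
  (ω : Ω')

theorem hitSum_eq_sum_pathsThrough (f : ℝ → ℝ) :
    hitSum (fun k ω => (p k ω, b k ω)) {x | x.1.1 j = i} (fun x => f x.2) n ω =
      ∑ k ∈ pathsThrough (fun k => p k ω) n j i, f (b k ω) := by
  simp [hitSum, pathsThrough, Finset.sum_filter, Set.indicator_apply]

theorem hitSum_one_eq_card :
    hitSum (fun k ω => (p k ω, b k ω)) {x | x.1.1 j = i} 1 n ω =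
      ((pathsThrough (fun k => p k ω) n j i).card : ℝ) := by
  simpa using! hitSum_eq_sum_pathsThrough p b n j i ω 1

end Estimators

/-! ### Algebraic identities for the estimators -/

section Algebra

variable (p : ℕ → N.Path) (b : ℕ → ℝ) (n : ℕ) (j : Fin c) (i : Fin (r j))

theorem sumMatrix_eq_sum : sumMatrix p b n j i = ∑ k ∈ pathsThrough p n j i, b k := by
  simp [sumMatrix, indicatorMatrix, pathsThrough, Finset.sum_filter]

/-- The default value `0` agrees with division by zero, so no case distinction remains. -/
theorem sampleMean_eq :
    sampleMean p b n j i =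
      (∑ k ∈ pathsThrough p n j i, b k) / ((pathsThrough p n j i).card : ℝ) := by
  rw [sampleMean, sumMatrix_eq_sum, countMatrix_eq_card]
  split_ifs with h
  · rfl
  · rw [not_not.1 h, div_zero]

theorem sampleVariance_eq :
    sampleVariance p b n j i =
      (∑ k ∈ pathsThrough p n j i, (b k - sampleMean p b n j i) ^ 2) /
        ((pathsThrough p n j i).card : ℝ) := by
  rw [sampleVariance, countMatrix_eq_card]
  split_ifs with h
  · rfl
  · rw [not_not.1 h, div_zero]

theorem sqrt_card_mul_sampleMean_sub (m : ℝ) :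
    √((pathsThrough p n j i).card : ℝ) * (sampleMean p b n j i - m) =
      (∑ k ∈ pathsThrough p n j i, (b k - m)) / √((pathsThrough p n j i).card : ℝ) := by
  rw [sampleMean_eq, Finset.sum_sub_distrib, Finset.sum_const, nsmul_eq_mul]
  rcases Nat.eq_zero_or_pos (pathsThrough p n j i).card with h | h
  · simp [h]
  · have h' : (0 : ℝ) < (pathsThrough p n j i).card := Nat.cast_pos.2 h
    have hs := Real.sqrt_pos.2 h'
    rw [eq_div_iff hs.ne', mul_right_comm, Real.mul_self_sqrt h'.le]
    field_simp

/-- The bias-variance decomposition of the sample variance. -/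
theorem sqrt_card_mul_sampleVariance_sub (m v : ℝ) :
    √((pathsThrough p n j i).card : ℝ) * (sampleVariance p b n j i - v) =
      (∑ k ∈ pathsThrough p n j i, ((b k - m) ^ 2 - v)) / √((pathsThrough p n j i).card : ℝ) -
      (∑ k ∈ pathsThrough p n j i, (b k - m)) / √((pathsThrough p n j i).card : ℝ) *
        ((∑ k ∈ pathsThrough p n j i, (b k - m)) / ((pathsThrough p n j i).card : ℝ)) := by
  rcases Nat.eq_zero_or_pos (pathsThrough p n j i).card with h | h
  · simp [h]
  · have h' : (0 : ℝ) < (pathsThrough p n j i).card := Nat.cast_pos.2 h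
    have hs := Real.sqrt_pos.2 h'
    have hmean : ∑ k ∈ pathsThrough p n j i, (b k - m) =
        (pathsThrough p n j i).card * (sampleMean p b n j i - m) := by
      rw [sampleMean_eq, Finset.sum_sub_distrib, Finset.sum_const, nsmul_eq_mul]
      field_simp
    have hsq : ∑ k ∈ pathsThrough p n j i, (b k - sampleMean p b n j i) ^ 2 =
        ∑ k ∈ pathsThrough p n j i, (b k - m) ^ 2 -
          (pathsThrough p n j i).card * (sampleMean p b n j i - m) ^ 2 := by
      -- Expansion about `m`: summing, the cross term gives `-2 count (T - m)²` and the last term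
      -- `+count (T - m)²`.
      have (k : ℕ) : (b k - sampleMean p b n j i) ^ 2 = (b k - m) ^ 2 -
          2 * (sampleMean p b n j i - m) * (b k - m) + (sampleMean p b n j i - m) ^ 2 := by ring
      simp only [this, Finset.sum_add_distrib, Finset.sum_sub_distrib (fun k => (b k - m) ^ 2),
        ← Finset.mul_sum, hmean, Finset.sum_const, nsmul_eq_mul]
      ring
    rw [sampleVariance_eq, hsq, hmean, Finset.sum_sub_distrib, Finset.sum_const, nsmul_eq_mul,
      div_mul_eq_mul_div, ← sub_div, eq_div_iff hs.ne', mul_right_comm, Real.mul_self_sqrt h'.le]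
    field_simp
    ring

end Algebra

end PathNetwork

/-! ### The two central limit theorems -/

theorem mainTheorem2 {c : ℕ} {r : Fin c → ℕ} (N : PathNetwork.Network r)
    -- the model: a random path `X`, uniform on all paths, and a random quality matrix `S`
    {Ω : Type*} [MeasurableSpace Ω] (P : Measure Ω) [IsProbabilityMeasure P]
    (X : Ω → N.Path) (S : Ω → PathNetwork.QualityMatrix r)
    (hX : Measurable X) (hS : Measurable S)
    (huniform : P.map X = uniformOn Set.univ)
    (hindep : iIndepFun (fun (e : (j : Fin c) × Fin (r j)) ω => S ω e.1 e.2) P)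
    (hmoment : ∀ (j : Fin c) (i : Fin (r j)), MemLp (fun ω => S ω j i) 2 P)
    -- the data: i.i.d. copies `(p k, b k)` of the pair `(X, b(X))`
    {Ω' : Type*} [MeasurableSpace Ω'] (Q : Measure Ω') [IsProbabilityMeasure Q]
    (p : ℕ → Ω' → N.Path) (b : ℕ → Ω' → ℝ)
    (hp : ∀ k, Measurable (p k)) (hb : ∀ k, Measurable (b k))
    (hdata_indep : iIndepFun (fun k ω => (p k ω, b k ω)) Q)
    (hdata_law : ∀ k, IdentDistrib (fun ω => (p k ω, b k ω))
      (fun ω => (X ω, PathNetwork.quality (S ω) (X ω))) Q P)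
    -- a node that lies on some path
    (j : Fin c) (i : Fin (r j)) (hij : ∃ q : N.Path, q.1 j = i) :
    (0 ≤ PathNetwork.condVariance P X S j i ∧
      TendstoInDistribution
        (fun (n : ℕ) ω =>
          √((PathNetwork.pathsThrough (fun k => p k ω) n j i).card : ℝ) *
            (PathNetwork.sampleMean (fun k => p k ω) (fun k => b k ω) n j i -
              PathNetwork.condMean P X S j i))
        atTop (id : ℝ → ℝ) (fun _ => Q)
        (gaussianReal 0 (PathNetwork.condVariance P X S j i).toNNReal)) ∧
    ((∀ (j' : Fin c) (i' : Fin (r j')), MemLp (fun ω => S ω j' i') 4 P) →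
      0 ≤ PathNetwork.condTauSq P X S j i ∧
      TendstoInDistribution
        (fun (n : ℕ) ω =>
          √((PathNetwork.pathsThrough (fun k => p k ω) n j i).card : ℝ) *
            (PathNetwork.sampleVariance (fun k => p k ω) (fun k => b k ω) n j i -
              PathNetwork.condVariance P X S j i))
        atTop (id : ℝ → ℝ) (fun _ => Q)
        (gaussianReal 0 (PathNetwork.condTauSq P X S j i).toNNReal)) := by
  have hA : MeasurableSet {x : N.Path × ℝ | x.1.1 j = i} :=
    PathNetwork.measurableSet_preimage_node measurable_fst j i
  have hz (k : ℕ) : Measurable fun ω => (p k ω, b k ω) := (hp k).prodMk (hb k)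
  have hW : Measurable fun ω => (X ω, PathNetwork.quality (S ω) (X ω)) :=
    hX.prodMk (PathNetwork.measurable_quality hX hS)
  have hnode := PathNetwork.measure_node_ne_zero hX huniform hij
  have hprob : IsProbabilityMeasure (PathNetwork.condThrough P X j i) :=
    cond_isProbabilityMeasure hnode
  have hL := PathNetwork.memLp_quality (X := X) hX hmoment
  have hLc : MemLp _ 2 (PathNetwork.condThrough P X j i) := PathNetwork.memLp_cond hnode hL
  have hLsub : MemLp (fun ω => PathNetwork.quality (S ω) (X ω) - PathNetwork.condMean P X S j i)
    2 P := hL.sub (memLp_const _)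
  have hvar := PathNetwork.condVariance_eq_integral hLc
  have hmean : ∫ ω, (PathNetwork.quality (S ω) (X ω) - PathNetwork.condMean P X S j i)
      ∂(PathNetwork.condThrough P X j i) = 0 := by
    rw [integral_sub (hLc.integrable one_le_two) (integrable_const _)]
    simp [PathNetwork.condMean]
  have hclt := PathNetwork.tendstoInDistribution_hitSum_div_sqrt_hitCount
    (f := fun x : N.Path × ℝ => x.2 - PathNetwork.condMean P X S j i)
    hz hdata_law hdata_indep hW hA hnode (by fun_prop) hLsub hmean hvar.symm
  refine ⟨⟨hvar ▸ integral_nonneg fun ω => sq_nonneg _, ?_⟩, fun hmoment4 => ?_⟩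
  · refine hclt.congr (fun n => ae_of_all _ fun ω => ?_) (ae_of_all _ fun _ => rfl)
    simp only [PathNetwork.sqrt_card_mul_sampleMean_sub, PathNetwork.hitSum_one_eq_card,
      PathNetwork.hitSum_eq_sum_pathsThrough (f := fun y => y - PathNetwork.condMean P X S j i)]
  have hLsq : MemLp
      (fun ω => (PathNetwork.quality (S ω) (X ω) - PathNetwork.condMean P X S j i) ^ 2) 2 P :=
    PathNetwork.memLp_two_sq
      ((PathNetwork.memLp_quality (X := X) hX hmoment4).sub (memLp_const _))
  have hLsqc : MemLp _ 2 (PathNetwork.condThrough P X j i) := PathNetwork.memLp_cond hnode hLsq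
  have htau := PathNetwork.condTauSq_eq_integral hLc hLsqc
  have hmean' : ∫ ω, ((PathNetwork.quality (S ω) (X ω) - PathNetwork.condMean P X S j i) ^ 2 -
      PathNetwork.condVariance P X S j i) ∂(PathNetwork.condThrough P X j i) = 0 := by
    rw [integral_sub (hLsqc.integrable one_le_two) (integrable_const _), hvar]
    simp
  have hclt' := PathNetwork.tendstoInDistribution_hitSum_div_sqrt_hitCount
    (f := fun x : N.Path × ℝ => (x.2 - PathNetwork.condMean P X S j i) ^ 2 -
      PathNetwork.condVariance P X S j i)
    hz hdata_law hdata_indep hW hA hnode (by fun_prop) (hLsq.sub (memLp_const _)) hmean' htau.symm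
  refine ⟨htau ▸ integral_nonneg fun ω => sq_nonneg _, ?_⟩
  have hmeas := PathNetwork.measurable_hitSum
    (f := fun x : N.Path × ℝ => x.2 - PathNetwork.condMean P X S j i) hz hA (by fun_prop)
  have hmeas_one := PathNetwork.measurable_hitSum hz hA measurable_one
  -- The error from centring at the sample mean: the first factor converges in law by the CLT for `b
  -- - μ`, the second tends to `0` by the law of large numbers.
  have hrem := PathNetwork.tendstoInMeasure_mul_zero hclt
    (PathNetwork.tendstoInMeasure_hitSum_div_hitCount
      (f := fun x : N.Path × ℝ => x.2 - PathNetwork.condMean P X S j i) hz hdata_law hdata_indep hW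
      hA hnode (by fun_prop) (hLsub.integrable one_le_two) hmean)
    fun n => ((hmeas n).div (hmeas_one n)).aemeasurable
  have := hclt'.continuous_comp_prodMk_of_tendstoInMeasure_const
    (g := fun x : ℝ × ℝ => x.1 - x.2) (by fun_prop) hrem fun n =>
      (((hmeas n).div (hmeas_one n).sqrt).mul ((hmeas n).div (hmeas_one n))).aemeasurable
  refine this.congr (fun n => ae_of_all _ fun ω => ?_) (ae_of_all _ fun x => sub_zero x)
  simp only [
    PathNetwork.sqrt_card_mul_sampleVariance_sub _ _ n j i (PathNetwork.condMean P X S j i),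
    PathNetwork.hitSum_one_eq_card,
    PathNetwork.hitSum_eq_sum_pathsThrough (f := fun y => y - PathNetwork.condMean P X S j i),
    PathNetwork.hitSum_eq_sum_pathsThrough (f := fun y =>
      (y - PathNetwork.condMean P X S j i) ^ 2 - PathNetwork.condVariance P X S j i)]
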